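/- Let $G$ be a finitely generated group. A norm on $G$ is a function $\|\cdot\|:G\to[0,\infty)$ such that $\|g\|=0$ if and only if $g=e$, and $\|gh\|\le\|g\|+\|h\|$ for all $g,h\in G$; its volume function is $V(r)=\#\{g\in G:\|g\|\le r\}$. For nonnegative functions $f,h$, the relation $f\simeq h$ on a set means that there are constants $c,C\in(0,\infty)$ with $c\,h\le f\le C\,h$ on that set. A symmetric probability measure $\mu$ on $G$ is $(\|\cdot\|,r)$-controlled, where $r:(0,\infty)\to(0,\infty)$ is non-decreasing, if (1) $\mu^{(2n)}(e)\simeq V(r(n))^{-1}$ for integers $n\ge1$, where $\mu^{(n)}$ is the $n$-th convolution power of $\mu$; and (2) for every $\epsilon>0$ there is $\gamma\in(0,\infty)$ such that for all $n\ge1$, $\mathbf P\big(\sup_{0\le k\le n}\|X_k\|\ge\gamma\, r(n)\big)\le\epsilon$, where $X_0=e$, $X_k=\xi_1\cdots\xi_k$ and $\xi_1,\xi_2,\dots$ are i.i.d. with law $\mu$. Theorem. Let $\|\cdot\|$ be a norm on $G$ whose volume function $V$ is finite and regularly varying at infinity of positive index $d$, that is, $V(\lambda t)/V(t)\to\lambda^{d}$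 as $t\to\infty$ for every $\lambda>0$. Let $\alpha\in(0,2)$ and let $\nu_\alpha$ be a symmetric probability measure on $G$ such that $$\nu_\alpha(x)\simeq\frac{1}{(1+\|x\|)^{\alpha}\,V(\|x\|)},\qquad x\in G.$$ Then $$\nu_\alpha^{(n)}(e)\simeq V(n^{1/\alpha})^{-1}\qquad(n\ge1),$$ and $\nu_\alpha$ is $(\|\cdot\|,\,t\mapsto t^{1/\alpha})$-controlled. -/

import Mathlib

open MeasureTheory Filter Topology Set

noncomputable section

namespace WalkControl

/-- A norm on a group: a nonnegative subadditive function that vanishes exactly at the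
identity. Symmetry under inversion is not part of the definition. -/
structure IsNorm {G : Type*} [Group G] (N : G → ℝ) : Prop where
  nonneg : ∀ g, 0 ≤ N g
  eq_zero_iff : ∀ g, N g = 0 ↔ g = 1
  mul_le : ∀ g h, N (g * h) ≤ N g + N h

/-- The volume function `V(r) = #{g : N g ≤ r}`. (An infinite ball would get the value `0`;
since a regularly varying function is positive near infinity, regular variation of the volume
function entails that all balls are finite.) -/
def ballVolume {G : Type*} (N : G → ℝ) (r : ℝ) : ℝ :=
  (Set.ncard {g : G | N g ≤ r} : ℝ)

/-- `f` is regularly varying (at infinity) of index `d`: it is positive and measurable on a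
neighbourhood of infinity and `f (l t) / f t → l ^ d` as `t → ∞`, for every `l > 0`. -/
def RegularlyVarying (f : ℝ → ℝ) (d : ℝ) : Prop :=
  (∃ X : ℝ, (∀ t, X ≤ t → 0 < f t) ∧ Measurable ((Set.Ici X).domRestrict f)) ∧
    ∀ l : ℝ, 0 < l → Tendsto (fun t => f (l * t) / f t) atTop (𝓝 (l ^ d))

/-- `f ≃ g` on `S`: `c g ≤ f ≤ C g` on `S` for some constants `c, C ∈ (0, ∞)`. -/
def ComparableOn {ι : Type*} (S : Set ι) (f g : ι → ℝ) : Prop :=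
  ∃ c C : ℝ, 0 < c ∧ 0 < C ∧ ∀ i ∈ S, c * g i ≤ f i ∧ f i ≤ C * g i

/-- A probability measure on a group is symmetric if `ν (x⁻¹) = ν x` for all `x`. -/
def IsSymm {G : Type*} [Group G] (ν : PMF G) : Prop :=
  ∀ x : G, ν x⁻¹ = ν x

/-- The convolution of two probability measures on a group: the law of `x * y` where `x` and
`y` are independent with laws `μ` and `ν`. -/
def conv {G : Type*} [Group G] (μ ν : PMF G) : PMF G :=
  μ.bind fun x => ν.map fun y => x * y

/-- The convolution powers of a probability measure on a group. -/
def convPow {G : Type*} [Group G] (ν : PMF G) : ℕ → PMF G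
  | 0 => PMF.pure 1
  | n + 1 => conv (convPow ν n) ν

/-- The position at time `n` of the walk started at the identity with successive increments
`ξ 0, ξ 1, …`, namely `ξ 0 * ξ 1 * ⋯ * ξ (n - 1)`. -/
def walk {G : Type*} [Group G] (ξ : ℕ → G) : ℕ → G
  | 0 => 1
  | n + 1 => walk ξ n * ξ n

/-- The law of an i.i.d. sequence of increments with common law `ν`. -/
def incrementLaw {G : Type*} [MeasurableSpace G] (ν : PMF G) : Measure (ℕ → G) :=
  Measure.infinitePi fun _ : ℕ => ν.toMeasure

/-- `max {N (X_k) : 0 ≤ k ≤ n}` along the walk with increments `ξ`. -/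
def runningMax {G : Type*} [Group G] (N : G → ℝ) (ξ : ℕ → G) (n : ℕ) : ℝ :=
  (Finset.range (n + 1)).sup' Finset.nonempty_range_add_one fun k => N (walk ξ k)

/-- `ν` is `(N, r)`-controlled. The function `r` is used on `(0, ∞)` only. -/
structure IsControlled {G : Type*} [Group G] [MeasurableSpace G]
    (ν : PMF G) (N : G → ℝ) (r : ℝ → ℝ) : Prop where
  norm : IsNorm N
  symm : IsSymm ν
  pos : ∀ t : ℝ, 0 < t → 0 < r t
  mono : MonotoneOn r (Set.Ioi 0)
  return_prob : ComparableOn {n : ℕ | 1 ≤ n} (fun n => (convPow ν (2 * n) 1).toReal)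
    (fun n => (ballVolume N (r n))⁻¹)
  tight : ∀ ε : ℝ, 0 < ε → ∃ γ : ℝ, 0 < γ ∧ ∀ n : ℕ, 1 ≤ n →
    (incrementLaw ν).real {ξ | γ * r n ≤ runningMax N ξ n} ≤ ε

end WalkControl

end

open scoped ENNReal

namespace WalkControl

/-! ### Convolution powers of a symmetric measure. -/

section Convolution

variable {G : Type*} [Group G]

/-! Regular variation enters only through finiteness of balls and volume doubling. Three estimates
carry the proof.

Return upper bound. Since `ν 1 > 0`, the measure `ν * ν` dominates a multiple of the uniform law on
every ball of radius `R`, with mass of order `(1 + R) ^ (-α)`. As `ν^(2n)` is largest at the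
identity, `u n = ν^(2n)(1)` contracts towards `1 / V R` at that rate (`conv_apply_one_relaxation`).
Running this over half of the time at scale `R ≈ n ^ (1 / α)` and inducting on `n` gives
`exists_le_div_of_relaxation`.

Tail bound. The Dirichlet energy of a cutoff `f = (2r - N)⁺` grows at most linearly along even
powers of `ν` (`energy_convPow_le`), and one step costs `O(V r * r ^ (2 - α))` by the truncated
second moment. A jump from the ball of radius `r` to far away costs at least `r ^ 2` for each
starting point, so the chance of distance `≳ r` at time `k` is `O(k * r ^ (-α))`
(`exists_tailProb_le`).

Consequences. At distance `n ^ (1 / α)` the tail is as small as desired. Cauchy–Schwarz on the ball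
holding half of the mass gives the return lower bound, and Ottaviani's inequality passes from a
fixed time to the running maximum. Odd times cost a factor `ν 1`, or nothing. -/

theorem conv_apply (μ ν : PMF G) (z : G) :
    conv μ ν z = ∑' x, μ x * ν (x⁻¹ * z) := by
  classical
  simp only [conv, PMF.bind_apply, PMF.map_apply]
  refine tsum_congr fun x => ?_
  rw [tsum_eq_single (x⁻¹ * z)]
  · simp
  · intro y hy
    rw [if_neg]
    rintro rfl
    simp at hy

theorem tsum_conv_mul (μ ν : PMF G) (F : G → ℝ≥0∞) :
    ∑' z, conv μ ν z * F z = ∑' x, μ x * ∑' y, ν y * F (x * y) := by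
  simp_rw [conv_apply, ← ENNReal.tsum_mul_right]
  rw [ENNReal.tsum_comm]
  refine tsum_congr fun x => ?_
  simp_rw [mul_assoc, ENNReal.tsum_mul_left]
  rw [← (Equiv.mulLeft x).tsum_eq]
  simp

theorem conv_assoc (μ ν ρ : PMF G) : conv (conv μ ν) ρ = conv μ (conv ν ρ) := by
  ext z
  rw [conv_apply, tsum_conv_mul, conv_apply]
  refine tsum_congr fun x => ?_
  rw [conv_apply]
  simp [mul_assoc]

theorem conv_pure_one (μ : PMF G) : conv μ (PMF.pure 1) = μ := by
  simp [conv, PMF.pure_map]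

theorem pure_one_conv (μ : PMF G) : conv (PMF.pure 1) μ = μ := by
  simp [conv, show (fun y : G => y) = id from rfl, PMF.map_id]

theorem convPow_add (ν : PMF G) (m n : ℕ) :
    convPow ν (m + n) = conv (convPow ν m) (convPow ν n) := by
  induction n with
  | zero => simp [convPow, conv_pure_one]
  | succ n ih => rw [← add_assoc, convPow, ih, convPow, conv_assoc]

theorem convPow_one (ν : PMF G) : convPow ν 1 = ν := by
  simp [convPow, pure_one_conv]

theorem convPow_succ' (ν : PMF G) (n : ℕ) :
    convPow ν (n + 1) = conv ν (convPow ν n) := by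
  rw [add_comm, convPow_add, convPow_one]

theorem conv_inv {μ ν : PMF G} (hμ : IsSymm μ) (hν : IsSymm ν) (z : G) :
    conv μ ν z⁻¹ = conv ν μ z := by
  rw [conv_apply, conv_apply, ← (Equiv.mulLeft z⁻¹).tsum_eq]
  refine tsum_congr fun w => ?_
  rw [mul_comm, ← hν w, ← hμ (w⁻¹ * z)]
  simp

/-- Inversion reverses the order of the factors, which is harmless because powers of one measure
commute. -/
theorem IsSymm.convPow {ν : PMF G} (h : IsSymm ν) (n : ℕ) : IsSymm (convPow ν n) := by
  induction n with
  | zero => intro x; by_cases hx : x = 1 <;> simp [WalkControl.convPow, PMF.pure_apply, hx]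
  | succ n ih =>
    intro x
    rw [WalkControl.convPow, conv_inv ih h, ← convPow_succ', WalkControl.convPow]

theorem conv_apply_one {μ : PMF G} (hμ : IsSymm μ) (ν : PMF G) :
    conv ν μ 1 = ∑' x, ν x * μ x := by
  simp [conv_apply, hμ _]

theorem mul_le_conv_apply (μ ν : PMF G) (x y : G) : μ x * ν y ≤ conv μ ν (x * y) := by
  rw [conv_apply]
  refine le_trans ?_ (ENNReal.le_tsum x)
  simp

theorem two_mul_mul_le_sq_add_sq (a b : ℝ≥0∞) : 2 * (a * b) ≤ a * a + b * b := by
  induction a with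
  | top => simp
  | coe a =>
    induction b with
    | top => simp
    | coe b =>
      norm_cast
      have := two_mul_le_add_sq a b
      nlinarith [this]

/-- Cauchy–Schwarz, done termwise by `2ab ≤ a² + b²`; the substitution `x ↦ x⁻¹ * y` makes both
square sums equal. -/
theorem convPow_apply_le_one {ν : PMF G} (h : IsSymm ν) (n : ℕ) (y : G) :
    convPow ν (2 * n) y ≤ convPow ν (2 * n) 1 := by
  rw [two_mul, convPow_add, conv_apply_one (h.convPow n)]
  set p := convPow ν n
  have key : 2 * conv p p y ≤ 2 * ∑' x, p x * p x := by
    calc 2 * conv p p y = ∑' x, 2 * (p x * p (x⁻¹ * y)) := by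
          rw [conv_apply, ENNReal.tsum_mul_left]
      _ ≤ ∑' x, (p x * p x + p (x⁻¹ * y) * p (x⁻¹ * y)) :=
          ENNReal.tsum_le_tsum fun x => two_mul_mul_le_sq_add_sq _ _
      _ = 2 * ∑' x, p x * p x := by
          rw [ENNReal.tsum_add, two_mul]
          congr 1
          rw [← ((Equiv.inv G).trans (Equiv.mulRight y)).tsum_eq fun x => p x * p x]
          simp
  exact (ENNReal.mul_le_mul_iff_right (by simp) (by simp)).1 key

end Convolution

/-! ### Finite balls and volume doubling. -/

section Volume

variable {G : Type*} {N : G → ℝ}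

theorem RegularlyVarying.finite_ball {d : ℝ} (hV : RegularlyVarying (ballVolume N) d) (r : ℝ) :
    {g | N g ≤ r}.Finite := by
  obtain ⟨⟨X, hX, -⟩, -⟩ := hV
  have h := hX (max X r) (le_max_left _ _)
  rw [ballVolume, Nat.cast_pos] at h
  exact (Set.finite_of_ncard_pos h).subset fun g (hg : N g ≤ r) => hg.trans (le_max_right _ _)

theorem ballVolume_mono (hfin : ∀ r, {g | N g ≤ r}.Finite) : Monotone (ballVolume N) := by
  intro r s h
  exact Nat.cast_le.2 (Set.ncard_le_ncard (fun g hg => le_trans hg h) (hfin s))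

theorem one_le_ballVolume [Group G] (hN : IsNorm N) (hfin : ∀ r, {g | N g ≤ r}.Finite) {r : ℝ}
    (hr : 0 ≤ r) : 1 ≤ ballVolume N r := by
  have : 0 < {g | N g ≤ r}.ncard :=
    (Set.ncard_pos (hfin r)).2 ⟨1, by simpa [(hN.eq_zero_iff 1).2 rfl] using hr⟩
  exact Nat.one_le_cast.2 this

theorem tsum_indicator_ball (hfin : ∀ r, {g | N g ≤ r}.Finite) (r : ℝ) :
    ∑' x, {g | N g ≤ r}.indicator (1 : G → ℝ≥0∞) x = ENNReal.ofReal (ballVolume N r) := by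
  classical
  rw [tsum_eq_sum (s := (hfin r).toFinset)]
  · rw [Finset.sum_congr rfl (g := fun _ => (1 : ℝ≥0∞))]
    · simp [ballVolume, Set.ncard_eq_toFinset_card _ (hfin r)]
    · intro x hx
      simp only [Set.Finite.mem_toFinset] at hx
      simp [hx]
  · intro x hx
    simp only [Set.Finite.mem_toFinset] at hx
    simp [hx]

/-- Balls of proportional radii have comparable volumes. -/
def VolumeDoubling (N : G → ℝ) : Prop :=
  ∀ l : ℝ, 0 < l → ∃ D : ℝ, 0 < D ∧ ∀ r, 0 ≤ r → ballVolume N (l * r) ≤ D * ballVolume N r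

/-- Beyond a threshold the ratio is at most `l ^ d + 1`; below it, monotonicity bounds the left side
and `V ≥ 1` bounds the right. -/
theorem RegularlyVarying.volumeDoubling [Group G] (hN : IsNorm N) {d : ℝ}
    (hV : RegularlyVarying (ballVolume N) d) : VolumeDoubling N := by
  intro l hl
  have hfin := hV.finite_ball
  have hmono := ballVolume_mono hfin
  have h1 := (hV.2 l hl).eventually_le_const (lt_add_one (l ^ d))
  obtain ⟨T, hT⟩ := eventually_atTop.1 h1
  have hT0 : 0 ≤ l * max T 0 := by positivity
  have hpos : 0 < ballVolume N (l * max T 0) :=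
    lt_of_lt_of_le one_pos (one_le_ballVolume hN hfin hT0)
  refine ⟨max (l ^ d + 1) (ballVolume N (l * max T 0)), lt_max_of_lt_right hpos, ?_⟩
  intro r hr
  have hr1 := one_le_ballVolume hN hfin hr
  rcases le_total T r with h | h
  · have := hT r h
    rw [div_le_iff₀ (by linarith)] at this
    exact this.trans (by gcongr; exact le_max_left _ _)
  · calc ballVolume N (l * r) ≤ ballVolume N (l * max T 0) :=
          hmono (by gcongr; exact h.trans (le_max_left _ _))
      _ ≤ max (l ^ d + 1) (ballVolume N (l * max T 0)) * 1 := by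
          rw [mul_one]; exact le_max_right _ _
      _ ≤ _ := by gcongr

end Volume

/-! ### From relaxation at every scale to polynomial decay. -/

section Decay

/-- A sequence that relaxes towards `1 / V R` at rate `κ (1 + R) ^ (-α)`, for every scale `R`,
is dominated by `1 / V (n ^ (1 / α))`. -/
theorem exists_le_div_of_relaxation {u : ℕ → ℝ} {V : ℝ → ℝ} {α κ : ℝ} (hα : 0 < α) (hκ : 0 < κ)
    (hu1 : ∀ n, u n ≤ 1) (hu0 : ∀ n, 0 ≤ u n) (hV1 : ∀ r, 0 ≤ r → 1 ≤ V r) (hVm : Monotone V)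
    (hVd : ∀ l : ℝ, 0 < l → ∃ D : ℝ, 0 < D ∧ ∀ r, 0 ≤ r → V (l * r) ≤ D * V r)
    (hrate : ∀ R, 0 ≤ R → κ * (1 + R) ^ (-α) ≤ 1)
    (hrel : ∀ R, 0 ≤ R → ∀ n,
      u (n + 1) ≤ (1 - κ * (1 + R) ^ (-α)) * u n + κ * (1 + R) ^ (-α) / V R) :
    ∃ C : ℝ, 0 < C ∧ ∀ n : ℕ, u n ≤ C / V ((n : ℝ) ^ (1 / α)) := by
  -- Iteration at a fixed scale `R`: the affine recursion has fixed point `1 / V R`.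
  have block : ∀ R, 0 ≤ R → ∀ n m, u (n + m) ≤ Real.exp (-(κ * (1 + R) ^ (-α) * m)) * u n
      + 1 / V R := by
    intro R hR n m
    have ha1 := hrate R hR
    have hVR := hV1 R hR
    have h : u (n + m) ≤ (1 - κ * (1 + R) ^ (-α)) ^ m * u n + 1 / V R := by
      induction m with
      | zero => simp; linarith
      | succ m ih =>
        calc u (n + (m + 1)) ≤ _ := hrel R hR (n + m)
          _ ≤ (1 - κ * (1 + R) ^ (-α)) * ((1 - κ * (1 + R) ^ (-α)) ^ m * u n + 1 / V R)
              + κ * (1 + R) ^ (-α) / V R := by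
            have : 0 ≤ 1 - κ * (1 + R) ^ (-α) := by linarith
            gcongr
          _ = _ := by ring
    refine h.trans ?_
    gcongr
    · exact hu0 n
    · calc (1 - κ * (1 + R) ^ (-α)) ^ m ≤ (Real.exp (-(κ * (1 + R) ^ (-α)))) ^ m := by
            refine pow_le_pow_left₀ (by linarith) ?_ m
            exact Real.one_sub_le_exp_neg _
        _ = _ := by rw [← Real.exp_nat_mul]; ring_nf
  obtain ⟨D, hD, hVD⟩ := hVd (3 ^ (1 / α)) (by positivity)
  -- With scale `δ * n ^ (1 / α) ≥ 1`, the rate times `n / 2` is at least `2 * D`, and `exp (-2D) ≤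
  -- 1 / (2D)` beats the doubling loss `D` between times `n / 2` and `n`, leaving `C / 2`.
  set δ : ℝ := (4 * D / κ) ^ (-(1 / α)) / 2 with hδdef
  have hδ : 0 < δ := by positivity
  have hδα : (2 * δ) ^ (-α) = 4 * D / κ := by
    rw [hδdef, mul_div_cancel₀ _ two_ne_zero, ← Real.rpow_mul (by positivity)]
    rw [neg_mul_neg, one_div_mul_cancel hα.ne', Real.rpow_one]
  obtain ⟨D', hD', hVD'⟩ := hVd (1 / δ) (by positivity)
  -- The first bound ensures `n ≤ 3 * (n / 2)` for the floored half, the second that the scale is at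
  -- least `1`.
  obtain ⟨n₀, hn₀⟩ := exists_nat_ge (max 2 ((1 / δ) ^ α))
  have hn₀2 : (2 : ℝ) ≤ n₀ := (le_max_left _ _).trans hn₀
  set C := max (2 * D') (V ((n₀ : ℝ) ^ (1 / α)))
  have hC : 0 < C := lt_max_of_lt_left (by positivity)
  refine ⟨C, hC, fun n => ?_⟩
  induction n using Nat.strong_induction_on with
  | _ n ih =>
    have hVn : 1 ≤ V ((n : ℝ) ^ (1 / α)) := hV1 _ (by positivity)
    rw [le_div_iff₀ (by linarith)]
    rcases le_total n n₀ with hn | hn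
    · calc u n * V ((n : ℝ) ^ (1 / α)) ≤ 1 * V ((n₀ : ℝ) ^ (1 / α)) := by
            gcongr
            · exact hu1 n
            · exact hVm (by gcongr)
        _ ≤ C := by rw [one_mul]; exact le_max_right _ _
    · have hn₀' : 2 ≤ n₀ := by exact_mod_cast hn₀2
      have hnR : (n₀ : ℝ) ≤ n := by exact_mod_cast hn
      have hn0 : (0 : ℝ) < n := by linarith
      have hscale : 1 ≤ δ * (n : ℝ) ^ (1 / α) := by
        have h1 : (1 / δ) ^ α ≤ n := ((le_max_right _ _).trans hn₀).trans hnR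
        have h2 : ((1 / δ) ^ α) ^ (1 / α) ≤ (n : ℝ) ^ (1 / α) := by gcongr
        rw [← Real.rpow_mul (by positivity), mul_one_div_cancel hα.ne', Real.rpow_one] at h2
        rwa [div_le_iff₀' hδ] at h2
      have hb := block (δ * (n : ℝ) ^ (1 / α)) (by positivity) (n / 2) (n - n / 2)
      rw [show n / 2 + (n - n / 2) = n by omega] at hb
      have hm : (n : ℝ) / 2 ≤ ((n - n / 2 : ℕ) : ℝ) := by
        have : n ≤ 2 * (n - n / 2) := by omega
        have : (n : ℝ) ≤ 2 * ((n - n / 2 : ℕ) : ℝ) := by exact_mod_cast this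
        linarith
      have hrt : 4 * D / κ * (n : ℝ)⁻¹ ≤ (1 + δ * (n : ℝ) ^ (1 / α)) ^ (-α) := by
        calc 4 * D / κ * (n : ℝ)⁻¹ = (2 * δ * (n : ℝ) ^ (1 / α)) ^ (-α) := by
              rw [Real.mul_rpow (by positivity) (by positivity), hδα,
                ← Real.rpow_mul hn0.le]
              congr 1
              rw [mul_neg, one_div_mul_cancel hα.ne', Real.rpow_neg_one]
          _ ≤ _ := Real.rpow_le_rpow_of_nonpos (by positivity) (by linarith) (by linarith)
      have hexp : Real.exp (-(κ * (1 + δ * (n : ℝ) ^ (1 / α)) ^ (-α) * ((n - n / 2 : ℕ) : ℝ)))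
          ≤ 1 / (2 * D) := by
        have h1 : 2 * D ≤ κ * (1 + δ * (n : ℝ) ^ (1 / α)) ^ (-α) * ((n - n / 2 : ℕ) : ℝ) := by
          calc 2 * D = κ * (4 * D / κ * (n : ℝ)⁻¹) * (n / 2) := by field_simp; ring
            _ ≤ _ := by gcongr
        rw [Real.exp_neg, ← one_div]
        gcongr
        linarith [Real.add_one_le_exp
          (κ * (1 + δ * (n : ℝ) ^ (1 / α)) ^ (-α) * ((n - n / 2 : ℕ) : ℝ))]
      have hhalf := ih (n / 2) (by omega)
      have hVh : 1 ≤ V (((n / 2 : ℕ) : ℝ) ^ (1 / α)) := hV1 _ (by positivity)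
      have hV3 : V ((n : ℝ) ^ (1 / α)) ≤ D * V (((n / 2 : ℕ) : ℝ) ^ (1 / α)) := by
        refine le_trans (hVm ?_) (hVD _ (by positivity))
        rw [← Real.mul_rpow (by norm_num) (by positivity)]
        gcongr
        have : n ≤ 3 * (n / 2) := by omega
        exact_mod_cast this
      have hVδ : V ((n : ℝ) ^ (1 / α)) ≤ D' * V (δ * (n : ℝ) ^ (1 / α)) := by
        have := hVD' (δ * (n : ℝ) ^ (1 / α)) (by positivity)
        rwa [← mul_assoc, one_div_mul_cancel hδ.ne', one_mul] at this
      have hVR : 1 ≤ V (δ * (n : ℝ) ^ (1 / α)) := hV1 _ (by positivity)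
      have hle : u n ≤ 1 / (2 * D) * (C / V (((n / 2 : ℕ) : ℝ) ^ (1 / α)))
          + 1 / V (δ * (n : ℝ) ^ (1 / α)) := by
        refine hb.trans ?_
        gcongr
        exact hu0 _
      calc u n * V ((n : ℝ) ^ (1 / α))
          ≤ (1 / (2 * D) * (C / V (((n / 2 : ℕ) : ℝ) ^ (1 / α)))
            + 1 / V (δ * (n : ℝ) ^ (1 / α))) * V ((n : ℝ) ^ (1 / α)) := by gcongr
        _ = 1 / (2 * D) * (C / V (((n / 2 : ℕ) : ℝ) ^ (1 / α))) * V ((n : ℝ) ^ (1 / α))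
            + 1 / V (δ * (n : ℝ) ^ (1 / α)) * V ((n : ℝ) ^ (1 / α)) := by ring
        _ ≤ 1 / (2 * D) * (C / V (((n / 2 : ℕ) : ℝ) ^ (1 / α)))
              * (D * V (((n / 2 : ℕ) : ℝ) ^ (1 / α)))
            + 1 / V (δ * (n : ℝ) ^ (1 / α)) * (D' * V (δ * (n : ℝ) ^ (1 / α))) := by gcongr
        _ = C / 2 + D' := by field_simp
        _ ≤ C := by
            have : 2 * D' ≤ C := le_max_left _ _
            linarith

end Decay

end WalkControl

namespace WalkControl

/-! ### Upper bound for the return probability. -/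

section Diagonal

theorem toReal_apply_le_one {G : Type*} (μ : PMF G) (x : G) : (μ x).toReal ≤ 1 :=
  ENNReal.toReal_mono ENNReal.one_ne_top (μ.coe_le_one x)

variable {G : Type*} [Group G] {N : G → ℝ}

/-- Split `q` as `b` times the indicator of the ball plus a remainder. The remainder has mass `1 - b
* V R` and sees at most `m 1`; the ball part contributes at most `b` because `m` has total mass `1`.
The form avoids subtraction in `ℝ≥0∞`. -/
theorem conv_apply_one_relaxation (hfin : ∀ r, {g | N g ≤ r}.Finite) {q m : PMF G}
    (hm : IsSymm m) (hmax : ∀ y, m y ≤ m 1) {R : ℝ} {b : ℝ≥0∞} (hb : ∀ y, N y ≤ R → b ≤ q y) :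
    conv q m 1 + b * ENNReal.ofReal (ballVolume N R) * m 1 ≤ b + m 1 := by
  set I : G → ℝ≥0∞ := {g | N g ≤ R}.indicator 1 with hI
  have hle : ∀ y, b * I y ≤ q y := by
    intro y
    by_cases hy : N y ≤ R
    · simpa [hI, hy] using hb y hy
    · simp [hI, hy]
  have hI1 : ∀ y, I y ≤ 1 := fun y => Set.indicator_le_self' (by simp) y
  have hsum : ∑' y, (q y - b * I y) + b * ENNReal.ofReal (ballVolume N R) = 1 := by
    rw [← tsum_indicator_ball hfin, ← ENNReal.tsum_mul_left, ← ENNReal.tsum_add, ← q.tsum_coe]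
    exact tsum_congr fun y => tsub_add_cancel_of_le (hle y)
  have hconv : conv q m 1 ≤ (∑' y, (q y - b * I y)) * m 1 + b := by
    calc conv q m 1 = ∑' y, ((q y - b * I y) * m y + b * I y * m y) := by
          rw [conv_apply_one hm]
          refine tsum_congr fun y => ?_
          rw [← add_mul, tsub_add_cancel_of_le (hle y)]
      _ ≤ ∑' y, ((q y - b * I y) * m 1 + b * m y) := by
          refine ENNReal.tsum_le_tsum fun y => add_le_add ?_ ?_
          · gcongr; exact hmax y
          · calc b * I y * m y ≤ b * 1 * m y := by gcongr; exact hI1 y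
              _ = b * m y := by rw [mul_one]
      _ = _ := by rw [ENNReal.tsum_add, ENNReal.tsum_mul_right, ENNReal.tsum_mul_left, m.tsum_coe,
            mul_one]
  calc conv q m 1 + b * ENNReal.ofReal (ballVolume N R) * m 1
      ≤ (∑' y, (q y - b * I y)) * m 1 + b + b * ENNReal.ofReal (ballVolume N R) * m 1 := by gcongr
    _ = b + (∑' y, (q y - b * I y) + b * ENNReal.ofReal (ballVolume N R)) * m 1 := by ring
    _ = b + m 1 := by rw [hsum, one_mul]

theorem convPow_one_apply_le_half {ν : PMF G} (h : IsSymm ν) (n : ℕ) :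
    convPow ν n 1 ≤ convPow ν (2 * (n / 2)) 1 := by
  rcases Nat.mod_two_eq_zero_or_one n with h0 | h1
  · rw [show 2 * (n / 2) = n by omega]
  · conv_lhs => rw [show n = 2 * (n / 2) + 1 by omega]
    rw [convPow, conv_apply_one h]
    calc ∑' x, convPow ν (2 * (n / 2)) x * ν x
        ≤ ∑' x, convPow ν (2 * (n / 2)) 1 * ν x :=
          ENNReal.tsum_le_tsum fun x => by gcongr; exact convPow_apply_le_one h _ x
      _ = _ := by rw [ENNReal.tsum_mul_left, ν.tsum_coe, mul_one]

theorem exists_convPow_one_le (hN : IsNorm N) (hfin : ∀ r, {g | N g ≤ r}.Finite)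
    (hdbl : VolumeDoubling N) {α : ℝ} (hα : 0 < α) {ν : PMF G} (hsymm : IsSymm ν)
    {c : ℝ} (hc : 0 < c)
    (hν : ∀ x, c * (1 / ((1 + N x) ^ α * ballVolume N (N x))) ≤ (ν x).toReal) :
    ∃ C : ℝ, 0 < C ∧ ∀ n : ℕ,
      (convPow ν n 1).toReal ≤ C / ballVolume N ((n : ℝ) ^ (1 / α)) := by
  have hmono := ballVolume_mono hfin
  have hV1 : ∀ r, 0 ≤ r → 1 ≤ ballVolume N r := fun r hr => one_le_ballVolume hN hfin hr
  have hν1 : 0 < (ν 1).toReal := by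
    refine lt_of_lt_of_le ?_ (hν 1)
    have h0 : N 1 = 0 := (hN.eq_zero_iff 1).2 rfl
    have := hV1 0 le_rfl
    rw [h0]
    positivity
  -- Two steps, one of them a stay at the identity: the relaxation is run with `q = ν * ν` so that
  -- times remain even.
  set κ := (ν 1).toReal * c with hκdef
  have hκ : 0 < κ := by positivity
  have hball : ∀ R, 0 ≤ R → ∀ y, N y ≤ R →
      ENNReal.ofReal (κ * (1 + R) ^ (-α) / ballVolume N R) ≤ convPow ν 2 y := by
    intro R hR y hy
    have h0 := hN.nonneg y
    have hVy := hV1 _ h0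
    have hVR := hV1 _ hR
    have h1 : κ * (1 + R) ^ (-α) / ballVolume N R ≤ (ν 1).toReal * (ν y).toReal := by
      rw [hκdef, mul_assoc, mul_div_assoc]
      gcongr
      refine le_trans ?_ (hν y)
      rw [Real.rpow_neg (by positivity), mul_div_assoc, ← one_div, div_div]
      gcongr
      exact hmono hy
    have h2 : ν 1 * ν y ≤ convPow ν 2 y := by
      have := mul_le_conv_apply ν ν 1 y
      rw [one_mul] at this
      simpa only [convPow, pure_one_conv] using this
    refine le_trans ?_ h2
    rw [ENNReal.ofReal_le_iff_le_toReal, ENNReal.toReal_mul]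
    · exact h1
    · exact ENNReal.mul_ne_top (ν.apply_ne_top _) (ν.apply_ne_top _)
  have hstep : ∀ R, 0 ≤ R → ∀ n : ℕ,
      (convPow ν (2 * (n + 1)) 1).toReal + κ * (1 + R) ^ (-α) * (convPow ν (2 * n) 1).toReal
        ≤ κ * (1 + R) ^ (-α) / ballVolume N R + (convPow ν (2 * n) 1).toReal := by
    intro R hR n
    have hVR := hV1 _ hR
    have h := conv_apply_one_relaxation hfin (hsymm.convPow (2 * n))
      (convPow_apply_le_one hsymm n) (hball R hR)
    rw [← convPow_add, show 2 + 2 * n = 2 * (n + 1) by ring] at h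
    have h' := ENNReal.toReal_mono (by simp [PMF.apply_ne_top]) h
    rw [ENNReal.toReal_add (PMF.apply_ne_top _ _)
        (by simp [ENNReal.mul_eq_top, PMF.apply_ne_top]),
      ENNReal.toReal_add (by simp) (PMF.apply_ne_top _ _), ENNReal.toReal_mul,
      ENNReal.toReal_mul, ENNReal.toReal_ofReal (by positivity),
      ENNReal.toReal_ofReal (by positivity), div_mul_cancel₀ _ (by positivity)] at h'
    exact h'
  -- At `R = 0` the ball is `{1}`, so `hball` reads `κ ≤ ν^(2)(1) ≤ 1`.
  have hrate : ∀ R, 0 ≤ R → κ * (1 + R) ^ (-α) ≤ 1 := by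
    intro R hR
    have hk1 : κ ≤ 1 := by
      have h0 : N 1 = 0 := (hN.eq_zero_iff 1).2 rfl
      have h2 := hball 0 le_rfl 1 h0.le
      have hV0 : ballVolume N 0 = 1 := by
        have : {g | N g ≤ 0} = {1} := by
          ext g
          simp only [Set.mem_ofPred_eq, Set.mem_singleton_iff]
          rw [← hN.eq_zero_iff g]
          exact ⟨fun h => le_antisymm h (hN.nonneg g), fun h => h.le⟩
        simp [ballVolume, this]
      rw [hV0] at h2
      simp only [add_zero, Real.one_rpow, mul_one, div_one] at h2
      have := h2.trans (PMF.coe_le_one _ _)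
      simpa using this
    calc κ * (1 + R) ^ (-α) ≤ 1 * 1 := by
          gcongr
          exact Real.rpow_le_one_of_one_le_of_nonpos (by linarith) (by linarith)
      _ = 1 := one_mul 1
  obtain ⟨C, hC, hCu⟩ := exists_le_div_of_relaxation (u := fun n => (convPow ν (2 * n) 1).toReal)
    hα hκ (fun n => toReal_apply_le_one _ _) (fun n => ENNReal.toReal_nonneg) hV1 hmono hdbl
    hrate (fun R hR n => by linarith [hstep R hR n])
  obtain ⟨D, hD, hVD⟩ := hdbl (3 ^ (1 / α)) (by positivity)
  refine ⟨max (C * D) (ballVolume N 1), lt_max_of_lt_left (by positivity), fun n => ?_⟩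
  have hVn := hV1 ((n : ℝ) ^ (1 / α)) (by positivity)
  rw [le_div_iff₀ (by linarith)]
  rcases le_or_gt n 1 with hn | hn
  · calc (convPow ν n 1).toReal * ballVolume N ((n : ℝ) ^ (1 / α)) ≤ 1 * ballVolume N 1 := by
          gcongr
          · exact toReal_apply_le_one _ _
          · exact hmono (Real.rpow_le_one (by positivity) (by exact_mod_cast hn) (by positivity))
      _ ≤ _ := by rw [one_mul]; exact le_max_right _ _
  · have hVh := hV1 (((n / 2 : ℕ) : ℝ) ^ (1 / α)) (by positivity)
    have hV3 : ballVolume N ((n : ℝ) ^ (1 / α))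
        ≤ D * ballVolume N (((n / 2 : ℕ) : ℝ) ^ (1 / α)) := by
      refine le_trans (hmono ?_) (hVD _ (by positivity))
      rw [← Real.mul_rpow (by norm_num) (by positivity)]
      gcongr
      have : n ≤ 3 * (n / 2) := by omega
      exact_mod_cast this
    calc (convPow ν n 1).toReal * ballVolume N ((n : ℝ) ^ (1 / α))
        ≤ C / ballVolume N (((n / 2 : ℕ) : ℝ) ^ (1 / α))
            * (D * ballVolume N (((n / 2 : ℕ) : ℝ) ^ (1 / α))) := by
          gcongr
          exact (ENNReal.toReal_mono (PMF.apply_ne_top _ _)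
            (convPow_one_apply_le_half hsymm n)).trans (hCu (n / 2))
      _ = C * D := by field_simp
      _ ≤ _ := le_max_left _ _

end Diagonal

end WalkControl

namespace WalkControl

/-! ### Dirichlet energy along convolution powers. -/

section Energy

variable {G : Type*} [Group G]

/-- The mean of `f` after one step of law `μ`. -/
noncomputable def smoothing (μ : PMF G) (f : G → ℝ≥0∞) (x : G) : ℝ≥0∞ := ∑' y, μ y * f (x * y)

/-- The pairing of `f` with its mean after one step of law `μ`. -/
noncomputable def correlation (f : G → ℝ≥0∞) (μ : PMF G) : ℝ≥0∞ := ∑' x, f x * smoothing μ f x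

/-- Twice the Dirichlet energy of `f` for the random walk with step law `μ`. -/
noncomputable def energy (f : G → ℝ) (μ : PMF G) : ℝ≥0∞ :=
  ∑' x, ∑' z, μ z * ENNReal.ofReal ((f (x * z) - f x) ^ 2)

theorem smoothing_conv (μ ν : PMF G) (f : G → ℝ≥0∞) :
    smoothing (conv μ ν) f = smoothing μ (smoothing ν f) := by
  funext x
  simp only [smoothing]
  rw [tsum_conv_mul]
  simp [mul_assoc]

theorem tsum_mul_smoothing {μ : PMF G} (h : IsSymm μ) (f g : G → ℝ≥0∞) :
    ∑' x, f x * smoothing μ g x = ∑' x, smoothing μ f x * g x := by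
  simp only [smoothing, ← ENNReal.tsum_mul_left, ← ENNReal.tsum_mul_right]
  rw [ENNReal.tsum_comm]
  conv_rhs => rw [ENNReal.tsum_comm, ← (Equiv.inv G).tsum_eq]
  refine tsum_congr fun y => ?_
  rw [← (Equiv.mulRight y⁻¹).tsum_eq]
  refine tsum_congr fun x => ?_
  simp only [Equiv.coe_mulRight, Equiv.inv_apply, inv_mul_cancel_right, h y]
  ring

theorem correlation_conv {μ : PMF G} (h : IsSymm μ) (ν : PMF G) (f : G → ℝ≥0∞) :
    correlation f (conv μ ν) = ∑' x, smoothing μ f x * smoothing ν f x := by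
  rw [correlation, smoothing_conv, tsum_mul_smoothing h]

/-- Self-adjointness turns the left pairing into `⟨P^a f, P^b f⟩`, to which `2ab ≤ a² + b²` applies.
This convexity stands in for the spectral theorem. -/
theorem two_mul_correlation_le {ν : PMF G} (h : IsSymm ν) (f : G → ℝ≥0∞) (a b : ℕ) :
    2 * correlation f (convPow ν (a + b))
      ≤ correlation f (convPow ν (2 * a)) + correlation f (convPow ν (2 * b)) := by
  rw [two_mul a, two_mul b, convPow_add, convPow_add, convPow_add,
    correlation_conv (h.convPow _), correlation_conv (h.convPow _), correlation_conv (h.convPow _),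
    ← ENNReal.tsum_mul_left, ← ENNReal.tsum_add]
  exact ENNReal.tsum_le_tsum fun x => two_mul_mul_le_sq_add_sq _ _

theorem correlation_zero (ν : PMF G) (f : G → ℝ≥0∞) :
    correlation f (convPow ν 0) = ∑' x, f x * f x := by
  refine tsum_congr fun x => ?_
  rw [smoothing, tsum_eq_single 1]
  · simp [convPow, PMF.pure_apply]
  · intro y hy
    simp [convPow, PMF.pure_apply, hy]

/-- Expand the square; right translation preserves `∑ f²`. -/
theorem energy_add_correlation {f : G → ℝ} (hf : ∀ x, 0 ≤ f x) (μ : PMF G) :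
    energy f μ + 2 * correlation (fun x => ENNReal.ofReal (f x)) μ
      = 2 * ∑' x, ENNReal.ofReal (f x) * ENNReal.ofReal (f x) := by
  have h1 : ∀ x z, ENNReal.ofReal ((f (x * z) - f x) ^ 2)
      + 2 * (ENNReal.ofReal (f x) * ENNReal.ofReal (f (x * z)))
      = ENNReal.ofReal (f x) * ENNReal.ofReal (f x)
        + ENNReal.ofReal (f (x * z)) * ENNReal.ofReal (f (x * z)) := by
    intro x z
    have hx := hf x
    have hz := hf (x * z)
    rw [← ENNReal.ofReal_mul hx, ← ENNReal.ofReal_mul hx, ← ENNReal.ofReal_mul hz,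
      show (2 : ℝ≥0∞) = ENNReal.ofReal 2 by simp, ← ENNReal.ofReal_mul (by norm_num),
      ← ENNReal.ofReal_add (by positivity) (by positivity),
      ← ENNReal.ofReal_add (by positivity) (by positivity)]
    congr 1
    ring
  have h2 : energy f μ + 2 * correlation (fun x => ENNReal.ofReal (f x)) μ
      = ∑' x, ∑' z, μ z * (ENNReal.ofReal (f x) * ENNReal.ofReal (f x)
        + ENNReal.ofReal (f (x * z)) * ENNReal.ofReal (f (x * z))) := by
    simp only [energy, correlation, smoothing, ← ENNReal.tsum_mul_left, ← ENNReal.tsum_add]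
    refine tsum_congr fun x => tsum_congr fun z => ?_
    rw [← h1]
    ring
  rw [h2]
  simp only [mul_add, ENNReal.tsum_add, ENNReal.tsum_mul_right, μ.tsum_coe, one_mul]
  rw [two_mul]
  congr 1
  rw [ENNReal.tsum_comm]
  have h3 : ∀ z, ∑' x, μ z * (ENNReal.ofReal (f (x * z)) * ENNReal.ofReal (f (x * z)))
      = μ z * ∑' x, ENNReal.ofReal (f x) * ENNReal.ofReal (f x) := by
    intro z
    rw [ENNReal.tsum_mul_left,
      ← (Equiv.mulRight z).tsum_eq fun x => ENNReal.ofReal (f x) * ENNReal.ofReal (f x)]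
    simp
  simp_rw [h3, ENNReal.tsum_mul_right, μ.tsum_coe, one_mul]

/-- The decrements over two steps are non-increasing by the pair `(j, j + 2)`, and the first is at
most `2 * (q 0 - q 1)` by the pair `(0, 1)`. -/
theorem sub_le_two_mul_of_two_mul_le {q : ℕ → ℝ}
    (h : ∀ a b, 2 * q (a + b) ≤ q (2 * a) + q (2 * b)) (j : ℕ) :
    q 0 - q (2 * j) ≤ 2 * j * (q 0 - q 1) := by
  have hd : ∀ j, q (2 * j) - q (2 * (j + 1)) ≤ 2 * (q 0 - q 1) := by
    intro j
    induction j with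
    | zero => have := h 0 1; simp at this ⊢; linarith
    | succ j ih =>
      have := h j (j + 2)
      rw [show j + (j + 2) = 2 * (j + 1) by ring] at this
      rw [show j + 1 + 1 = j + 2 by ring]
      linarith
  induction j with
  | zero => simp
  | succ j ih => have := hd j; push_cast; linarith

theorem energy_convPow_le {ν : PMF G} (h : IsSymm ν) {f : G → ℝ} (hf : ∀ x, 0 ≤ f x)
    (hfin : ∑' x, ENNReal.ofReal (f x) * ENNReal.ofReal (f x) ≠ ⊤) (j : ℕ) :
    energy f (convPow ν (2 * j)) ≤ 2 * j * energy f ν := by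
  set F : G → ℝ≥0∞ := fun x => ENNReal.ofReal (f x) with hF
  set S := ∑' x, ENNReal.ofReal (f x) * ENNReal.ofReal (f x) with hS
  have hadd := fun μ : PMF G => energy_add_correlation hf μ
  have hE : ∀ μ : PMF G, energy f μ ≠ ⊤ := fun μ =>
    ne_top_of_le_ne_top (ENNReal.mul_ne_top (by simp) hfin) (le_self_add.trans (hadd μ).le)
  have hC : ∀ μ : PMF G, correlation F μ ≠ ⊤ := fun μ => by
    have h2 : 2 * correlation F μ ≠ ⊤ :=
      ne_top_of_le_ne_top (ENNReal.mul_ne_top (by simp) hfin) (le_add_self.trans (hadd μ).le)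
    exact fun h3 => h2 (by simp [h3])
  have hreal : ∀ μ : PMF G,
      (energy f μ).toReal + 2 * (correlation F μ).toReal = 2 * S.toReal := by
    intro μ
    have := congrArg ENNReal.toReal (hadd μ)
    rw [ENNReal.toReal_add (hE μ) (ENNReal.mul_ne_top (by simp) (hC μ)), ENNReal.toReal_mul,
      ENNReal.toReal_mul] at this
    simpa using this
  have hq := sub_le_two_mul_of_two_mul_le (q := fun k => (correlation F (convPow ν k)).toReal)
    (fun a b => by
      have := ENNReal.toReal_mono (ENNReal.add_ne_top.2 ⟨hC _, hC _⟩)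
        (two_mul_correlation_le h F a b)
      rw [ENNReal.toReal_add (hC _) (hC _), ENNReal.toReal_mul] at this
      simpa using this) j
  simp only [convPow_one, correlation_zero] at hq
  rw [show ∑' x, F x * F x = S from rfl] at hq
  have h1 := hreal ν
  have h2 := hreal (convPow ν (2 * j))
  rw [← ENNReal.toReal_le_toReal (hE _)
    (ENNReal.mul_ne_top (ENNReal.mul_ne_top (by simp) (by simp)) (hE _)), ENNReal.toReal_mul,
    ENNReal.toReal_mul]
  simp only [ENNReal.toReal_ofNat, ENNReal.toReal_natCast]
  have h3 : (energy f ν).toReal = 2 * (S.toReal - (correlation F ν).toReal) := by linarith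
  rw [h3]
  linarith

end Energy

/-! ### Truncated second moment and the energy of a cutoff. -/

section Tail

variable {G : Type*} {N : G → ℝ}

/-- The truncated second moment of a measure of index `α < 2`. -/
theorem exists_truncated_moment_le (hfin : ∀ r, {g | N g ≤ r}.Finite)
    (hnn : ∀ g, 0 ≤ N g) (hV1 : ∀ r, 0 ≤ r → 1 ≤ ballVolume N r)
    (hdbl : VolumeDoubling N) {α : ℝ} (hα : 0 < α) (hα2 : α < 2) {ν : PMF G}
    {C : ℝ} (hC : 0 < C)
    (hν : ∀ x, (ν x).toReal ≤ C * (1 / ((1 + N x) ^ α * ballVolume N (N x)))) :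
    ∃ A : ℝ, 0 < A ∧ ∀ K, 0 < K →
      ∑' z, ν z * ENNReal.ofReal ((min K (N z)) ^ 2) ≤ ENNReal.ofReal (A * K ^ (2 - α)) := by
  have hmono := ballVolume_mono hfin
  obtain ⟨D, hD, hVD⟩ := hdbl 2 two_pos
  -- Weight of the annulus `2^j K < N ≤ 2^(j+1) K` after scaling out `K ^ (2 - α)`. It decays
  -- geometrically as `j → ∞` since `α > 0`, and as `j → -∞` since `α < 2`.
  set w : ℤ → ℝ := fun j => (min 1 (2 ^ (j + 1))) ^ 2 * ((2 : ℝ) ^ j) ^ (-α) with hw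
  have hw0 : ∀ j, 0 ≤ w j := fun j => by positivity
  have hsum : Summable w := by
    refine Summable.of_nat_of_neg ?_ ?_
    · refine Summable.of_nonneg_of_le (fun n => hw0 _) (fun n => ?_)
        (summable_geometric_of_lt_one (r := (2 : ℝ) ^ (-α)) (by positivity)
          (Real.rpow_lt_one_of_one_lt_of_neg one_lt_two (by linarith)))
      have h1 : (min 1 ((2 : ℝ) ^ ((n : ℤ) + 1))) ^ 2 ≤ 1 :=
        pow_le_one₀ (by positivity) (min_le_left _ _)
      calc w n ≤ 1 * ((2 : ℝ) ^ (n : ℤ)) ^ (-α) := by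
            simp only [hw]; gcongr
        _ = ((2 : ℝ) ^ (-α)) ^ n := by
            rw [one_mul, zpow_natCast, ← Real.rpow_natCast, ← Real.rpow_natCast,
              ← Real.rpow_mul two_pos.le, ← Real.rpow_mul two_pos.le, mul_comm]
    · refine Summable.of_nonneg_of_le (fun n => hw0 _) (fun n => ?_)
        ((summable_geometric_of_lt_one (r := (2 : ℝ) ^ (α - 2)) (by positivity)
          (Real.rpow_lt_one_of_one_lt_of_neg one_lt_two (by linarith))).mul_left 4)
      calc w (-n) ≤ ((2 : ℝ) ^ (-(n : ℤ) + 1)) ^ 2 * ((2 : ℝ) ^ (-(n : ℤ))) ^ (-α) := by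
            simp only [hw]; gcongr; exact min_le_right _ _
        _ = 4 * ((2 : ℝ) ^ (α - 2)) ^ n := by
            rw [← Real.rpow_intCast, ← Real.rpow_intCast, ← Real.rpow_natCast,
              ← Real.rpow_natCast, ← Real.rpow_mul two_pos.le, ← Real.rpow_mul two_pos.le,
              ← Real.rpow_mul two_pos.le, ← Real.rpow_add two_pos,
              show (4 : ℝ) = 2 ^ (2 : ℝ) by norm_num, ← Real.rpow_add two_pos]
            congr 1
            push_cast
            ring
  refine ⟨C * D * ∑' j, w j + 1, by have : 0 ≤ ∑' j, w j := tsum_nonneg hw0; positivity, fun K hK => ?_⟩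
  set h : ℤ → ℝ := fun j => (min K (2 ^ (j + 1) * K)) ^ 2 *
    (C * (1 / ((2 ^ j * K) ^ α * ballVolume N (2 ^ j * K)))) with hh
  have hV2 : ∀ j : ℤ, 1 ≤ ballVolume N (2 ^ j * K) := fun j => hV1 _ (by positivity)
  have hh0 : ∀ j, 0 ≤ h j := fun j => by have := hV2 j; positivity
  have hpt : ∀ z, ν z * ENNReal.ofReal ((min K (N z)) ^ 2)
      ≤ ∑' j : ℤ, {g | N g ≤ 2 * (2 ^ j * K)}.indicator 1 z * ENNReal.ofReal (h j) := by
    intro z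
    rcases (hnn z).eq_or_lt with h0 | h0
    · simp [← h0, hK.le]
    · obtain ⟨j, hj1, hj2⟩ := exists_mem_Ioc_zpow (div_pos h0 hK) one_lt_two
      rw [lt_div_iff₀ hK] at hj1
      rw [div_le_iff₀ hK] at hj2
      refine le_trans ?_ (ENNReal.le_tsum j)
      have hmem : z ∈ {g | N g ≤ 2 * (2 ^ j * K)} := by
        change N z ≤ _
        rwa [← mul_assoc, ← zpow_one_add₀ two_ne_zero, add_comm]
      rw [Set.indicator_of_mem hmem, Pi.one_apply, one_mul,
        ← ENNReal.ofReal_toReal (ν.apply_ne_top z), ← ENNReal.ofReal_mul ENNReal.toReal_nonneg]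
      apply ENNReal.ofReal_le_ofReal
      rw [mul_comm]
      have := hV2 j
      simp only [hh]
      gcongr
      refine (hν z).trans ?_
      gcongr
      · linarith
      · exact hmono hj1.le
  have hterm : ∀ j : ℤ, ENNReal.ofReal (ballVolume N (2 * (2 ^ j * K))) * ENNReal.ofReal (h j)
      ≤ ENNReal.ofReal (C * D * K ^ (2 - α) * w j) := by
    intro j
    have hj := hV2 j
    have h2 : 1 ≤ ballVolume N (2 * (2 ^ j * K)) := hV1 _ (by positivity)
    rw [← ENNReal.ofReal_mul (by linarith)]
    apply ENNReal.ofReal_le_ofReal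
    calc ballVolume N (2 * (2 ^ j * K)) * h j
        ≤ D * ballVolume N (2 ^ j * K) * h j := by
          gcongr
          exact hVD _ (by positivity)
      _ = C * D * K ^ (2 - α) * w j := by
          have hm : min K (2 ^ (j + 1) * K) = min 1 (2 ^ (j + 1)) * K := by
            rw [min_mul_of_nonneg _ _ hK.le, one_mul]
          simp only [hh, hw, hm]
          rw [Real.mul_rpow (by positivity) hK.le, Real.rpow_sub hK, Real.rpow_neg (by positivity),
            Real.rpow_two]
          field_simp
  calc ∑' z, ν z * ENNReal.ofReal ((min K (N z)) ^ 2)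
      ≤ ∑' z, ∑' j : ℤ, {g | N g ≤ 2 * (2 ^ j * K)}.indicator 1 z * ENNReal.ofReal (h j) :=
        ENNReal.tsum_le_tsum hpt
    _ = ∑' j : ℤ, ENNReal.ofReal (ballVolume N (2 * (2 ^ j * K))) * ENNReal.ofReal (h j) := by
        rw [ENNReal.tsum_comm]
        refine tsum_congr fun j => ?_
        rw [ENNReal.tsum_mul_right, tsum_indicator_ball hfin]
    _ ≤ ∑' j : ℤ, ENNReal.ofReal (C * D * K ^ (2 - α) * w j) := ENNReal.tsum_le_tsum hterm
    _ = ENNReal.ofReal (C * D * K ^ (2 - α) * ∑' j, w j) := by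
        rw [← tsum_mul_left, ENNReal.ofReal_tsum_of_nonneg _ (hsum.mul_left _)]
        intro j
        have := hw0 j
        positivity
    _ ≤ _ := by
        apply ENNReal.ofReal_le_ofReal
        have : 0 < K ^ (2 - α) := by positivity
        nlinarith [this]

variable [Group G]

/-- A substitute for symmetry of `N`. If `N x⁻¹ ≥ N x`, compare the two-sided bounds at `ν x = ν
x⁻¹`; by monotonicity the volumes cancel, leaving a comparison of `α`-th powers. -/
theorem exists_inv_le (hN : IsNorm N) (hfin : ∀ r, {g | N g ≤ r}.Finite) {α : ℝ} (hα : 0 < α)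
    {ν : PMF G} (hsymm : IsSymm ν) {c C : ℝ} (hc : 0 < c) (hC : 0 < C)
    (hν : ∀ x, c * (1 / ((1 + N x) ^ α * ballVolume N (N x))) ≤ (ν x).toReal)
    (hν' : ∀ x, (ν x).toReal ≤ C * (1 / ((1 + N x) ^ α * ballVolume N (N x)))) :
    ∃ A : ℝ, 1 ≤ A ∧ ∀ x, N x⁻¹ ≤ A * (1 + N x) := by
  refine ⟨max 1 ((C / c) ^ (1 / α)), le_max_left _ _, fun x => ?_⟩
  have h0 := hN.nonneg x
  have h0' := hN.nonneg x⁻¹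
  rcases le_total (N x⁻¹) (N x) with h | h
  · nlinarith [le_max_left 1 ((C / c) ^ (1 / α))]
  · have hV := one_le_ballVolume hN hfin h0
    have hV' := ballVolume_mono hfin h
    have h1 := (hν x).trans (((hsymm x).symm ▸ le_rfl : (ν x).toReal ≤ (ν x⁻¹).toReal).trans
      (hν' x⁻¹))
    have h2 : (1 + N x⁻¹) ^ α ≤ C / c * (1 + N x) ^ α := by
      have h3 : c * (1 / ((1 + N x) ^ α * ballVolume N (N x)))
          ≤ C * (1 / ((1 + N x⁻¹) ^ α * ballVolume N (N x))) := by
        refine h1.trans ?_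
        gcongr
      rw [mul_one_div, mul_one_div, div_le_div_iff₀ (by positivity) (by positivity)] at h3
      have h4 : c * (1 + N x⁻¹) ^ α ≤ C * (1 + N x) ^ α := by
        have : 0 < ballVolume N (N x) := by linarith
        nlinarith
      rw [div_mul_eq_mul_div, le_div_iff₀ hc]
      linarith
    have h5 : 1 + N x⁻¹ ≤ (C / c) ^ (1 / α) * (1 + N x) := by
      have := Real.rpow_le_rpow (by positivity) h2 (by positivity : 0 ≤ 1 / α)
      rwa [Real.mul_rpow (by positivity) (by positivity), ← Real.rpow_mul (by positivity),
        ← Real.rpow_mul (by positivity), mul_one_div_cancel hα.ne', Real.rpow_one,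
        Real.rpow_one] at this
    nlinarith [le_max_right 1 ((C / c) ^ (1 / α))]

/-- The energy of the cutoff function `(K - N)⁺` is controlled by the truncated second moment. -/
theorem energy_cutoff_le (hN : IsNorm N) (hfin : ∀ r, {g | N g ≤ r}.Finite) {ν : PMF G}
    (hsymm : IsSymm ν) {K : ℝ} (hK : 0 ≤ K) :
    energy (fun x => max (K - N x) 0) ν ≤ 4 * ENNReal.ofReal (ballVolume N K)
      * ∑' z, ν z * ENNReal.ofReal ((min K (N z)) ^ 2) := by
  set I : G → ℝ≥0∞ := {g | N g ≤ K}.indicator 1 with hI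
  set a : G → ℝ≥0∞ := fun z => ENNReal.ofReal ((min K (N z)) ^ 2) with ha
  -- The increment vanishes unless `x` or `x * z` lies in the ball; its size is at most `min K (N
  -- z)` or `min K (N z⁻¹)`, according to which endpoint is farther out.
  have hpt : ∀ x z, ENNReal.ofReal ((max (K - N (x * z)) 0 - max (K - N x) 0) ^ 2)
      ≤ (I x + I (x * z)) * (a z + a z⁻¹) := by
    intro x z
    have hb : ENNReal.ofReal ((max (K - N (x * z)) 0 - max (K - N x) 0) ^ 2) ≤ a z + a z⁻¹ := by
      have hx := hN.nonneg x
      have hxz := hN.nonneg (x * z)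
      have hz := hN.nonneg z
      have hz' := hN.nonneg z⁻¹
      have h1 := hN.mul_le x z
      have h2 := hN.mul_le (x * z) z⁻¹
      rw [mul_inv_cancel_right] at h2
      rcases le_total (N x) (N (x * z)) with h | h
      · refine le_trans (ENNReal.ofReal_le_ofReal ?_) le_self_add
        rw [← neg_sub, neg_sq]
        refine pow_le_pow_left₀ (sub_nonneg.2 (max_le_max (by linarith) le_rfl)) (le_min ?_ ?_) 2
        · rcases le_total (K - N x) 0 with h3 | h3 <;>
            rcases le_total (K - N (x * z)) 0 with h4 | h4 <;>
            simp only [max_eq_left, max_eq_right, h3, h4] <;> linarith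
        · rcases le_total (K - N x) 0 with h3 | h3 <;>
            rcases le_total (K - N (x * z)) 0 with h4 | h4 <;>
            simp only [max_eq_left, max_eq_right, h3, h4] <;> linarith
      · refine le_trans (ENNReal.ofReal_le_ofReal ?_) le_add_self
        refine pow_le_pow_left₀ (sub_nonneg.2 (max_le_max (by linarith) le_rfl)) (le_min ?_ ?_) 2
        · rcases le_total (K - N x) 0 with h3 | h3 <;>
            rcases le_total (K - N (x * z)) 0 with h4 | h4 <;>
            simp only [max_eq_left, max_eq_right, h3, h4] <;> linarith
        · rcases le_total (K - N x) 0 with h3 | h3 <;>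
            rcases le_total (K - N (x * z)) 0 with h4 | h4 <;>
            simp only [max_eq_left, max_eq_right, h3, h4] <;> linarith
    by_cases h1 : N x ≤ K
    · refine hb.trans ?_
      have : (1 : ℝ≥0∞) ≤ I x + I (x * z) := by simp [hI, h1]
      calc a z + a z⁻¹ = 1 * (a z + a z⁻¹) := (one_mul _).symm
        _ ≤ _ := by gcongr
    · by_cases h2 : N (x * z) ≤ K
      · refine hb.trans ?_
        have : (1 : ℝ≥0∞) ≤ I x + I (x * z) := by simp [hI, h2]
        calc a z + a z⁻¹ = 1 * (a z + a z⁻¹) := (one_mul _).symm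
          _ ≤ _ := by gcongr
      · push Not at h1 h2
        rw [max_eq_right (by linarith), max_eq_right (by linarith)]
        simp
  have hcount : ∀ z, ∑' x, (I x + I (x * z)) = 2 * ENNReal.ofReal (ballVolume N K) := by
    intro z
    rw [ENNReal.tsum_add, show ∑' x, I (x * z) = ∑' x, I x from (Equiv.mulRight z).tsum_eq I, ← two_mul, hI, tsum_indicator_ball hfin]
  have hinv : ∑' z, ν z * a z⁻¹ = ∑' z, ν z * a z := by
    rw [← (Equiv.inv G).tsum_eq]
    simp [hsymm _]
  calc energy (fun x => max (K - N x) 0) ν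
      ≤ ∑' x, ∑' z, ν z * ((I x + I (x * z)) * (a z + a z⁻¹)) :=
        ENNReal.tsum_le_tsum fun x => ENNReal.tsum_le_tsum fun z => by gcongr; exact hpt x z
    _ = ∑' z, 2 * ENNReal.ofReal (ballVolume N K) * (ν z * a z + ν z * a z⁻¹) := by
        rw [ENNReal.tsum_comm]
        refine tsum_congr fun z => ?_
        rw [ENNReal.tsum_mul_left, ENNReal.tsum_mul_right, hcount]
        ring
    _ = 4 * ENNReal.ofReal (ballVolume N K) * ∑' z, ν z * a z := by
        rw [ENNReal.tsum_mul_left, ENNReal.tsum_add, hinv]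
        ring

end Tail

end WalkControl

namespace WalkControl

/-! ### Tail of the walk at a fixed time, and the return lower bound. -/

section TailProb

variable {G : Type*} {N : G → ℝ}

/-- The probability that `N` is at least `L` under `μ`. -/
noncomputable def tailProb (N : G → ℝ) (μ : PMF G) (L : ℝ) : ℝ≥0∞ :=
  ∑' z, μ z * {g | L ≤ N g}.indicator 1 z

/-- The probability that `N` is at most `L` under `μ`. -/
noncomputable def headProb (N : G → ℝ) (μ : PMF G) (L : ℝ) : ℝ≥0∞ :=
  ∑' z, μ z * {g | N g ≤ L}.indicator 1 z

theorem one_le_headProb_add_tailProb (μ : PMF G) (L : ℝ) :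
    1 ≤ headProb N μ L + tailProb N μ L := by
  rw [headProb, tailProb, ← ENNReal.tsum_add, ← μ.tsum_coe]
  refine ENNReal.tsum_le_tsum fun z => ?_
  rcases le_total (N z) L with h | h
  · refine le_trans ?_ le_self_add
    simp [h]
  · refine le_trans ?_ le_add_self
    simp [h]

theorem half_le_headProb {μ : PMF G} {L : ℝ} (h : tailProb N μ L ≤ 2⁻¹) :
    2⁻¹ ≤ headProb N μ L := by
  rw [← ENNReal.one_sub_inv_two]
  exact tsub_le_iff_right.2 ((one_le_headProb_add_tailProb μ L).trans (by gcongr))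

variable [Group G]

/-- If `N x ≤ r` and `N z ≥ L`, then `N (x * z) ≥ L - N x⁻¹ ≥ 2r`, so the cutoff falls from at least
`r` to `0`. Such pairs bound the energy of the even power from below; linear growth bounds it from
above. -/
theorem tailProb_convPow_even_le (hN : IsNorm N) (hfin : ∀ r, {g | N g ≤ r}.Finite)
    {ν : PMF G} (hsymm : IsSymm ν) {A r L : ℝ} (hA : 0 ≤ A) (hinv : ∀ x, N x⁻¹ ≤ A * (1 + N x))
    (hr : 0 ≤ r) (hL : 2 * r + A * (1 + r) ≤ L) (j : ℕ) :
    ENNReal.ofReal (ballVolume N r) * tailProb N (convPow ν (2 * j)) L * ENNReal.ofReal (r ^ 2)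
      ≤ 2 * j * (4 * ENNReal.ofReal (ballVolume N (2 * r))
        * ∑' z, ν z * ENNReal.ofReal ((min (2 * r) (N z)) ^ 2)) := by
  set f : G → ℝ := fun x => max (2 * r - N x) 0 with hf
  have hf0 : ∀ x, 0 ≤ f x := fun x => le_max_right _ _
  have hsq : ∑' x, ENNReal.ofReal (f x) * ENNReal.ofReal (f x) ≠ ⊤ := by
    refine ne_top_of_le_ne_top (b := ENNReal.ofReal (2 * r * (2 * r))
      * ENNReal.ofReal (ballVolume N (2 * r))) (by finiteness) ?_
    rw [← tsum_indicator_ball hfin, ← ENNReal.tsum_mul_left]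
    refine ENNReal.tsum_le_tsum fun x => ?_
    rw [← ENNReal.ofReal_mul (hf0 x)]
    by_cases hx : N x ≤ 2 * r
    · have hfx : f x ≤ 2 * r := max_le (by linarith [hN.nonneg x]) (by linarith)
      simp only [Set.indicator, Set.mem_ofPred_eq, hx, if_true, Pi.one_apply, mul_one]
      apply ENNReal.ofReal_le_ofReal
      have := hf0 x
      gcongr
    · have : f x = 0 := max_eq_right (by linarith)
      simp [this]
  have hlow : ENNReal.ofReal (ballVolume N r) * tailProb N (convPow ν (2 * j)) L
      * ENNReal.ofReal (r ^ 2) ≤ energy f (convPow ν (2 * j)) := by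
    rw [← tsum_indicator_ball hfin, tailProb, energy]
    simp only [← ENNReal.tsum_mul_right, ← ENNReal.tsum_mul_left]
    rw [ENNReal.tsum_comm]
    refine ENNReal.tsum_le_tsum fun x => ENNReal.tsum_le_tsum fun z => ?_
    by_cases hx : N x ≤ r
    · by_cases hz : L ≤ N z
      · have h1 := hN.mul_le x⁻¹ (x * z)
        rw [inv_mul_cancel_left] at h1
        have h2 : A * (1 + N x) ≤ A * (1 + r) := by gcongr
        have h3 : f (x * z) = 0 := max_eq_right (by linarith [hinv x])
        have h4 : r ≤ f x := le_max_of_le_left (by linarith)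
        simp only [Set.indicator, Set.mem_ofPred_eq, hx, hz, if_true, Pi.one_apply, mul_one,
          one_mul, h3, zero_sub, neg_sq]
        gcongr
      · simp [hz]
    · simp [hx]
  refine hlow.trans ((energy_convPow_le hsymm hf0 hsq j).trans ?_)
  gcongr
  exact energy_cutoff_le hN hfin hsymm (by positivity)

theorem mul_tailProb_le (N : G → ℝ) (ν : PMF G) (k : ℕ) (L : ℝ) :
    ν 1 * tailProb N (convPow ν k) L ≤ tailProb N (convPow ν (k + 1)) L := by
  rw [tailProb, tailProb, ← ENNReal.tsum_mul_left]
  refine ENNReal.tsum_le_tsum fun z => ?_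
  rw [← mul_assoc]
  gcongr
  have := mul_le_conv_apply (convPow ν k) ν z 1
  rwa [mul_one, mul_comm] at this

theorem exists_tailProb_le (hN : IsNorm N) (hfin : ∀ r, {g | N g ≤ r}.Finite)
    (hdbl : VolumeDoubling N) {α : ℝ} (hα : 0 < α) (hα2 : α < 2) {ν : PMF G}
    (hsymm : IsSymm ν) {c C : ℝ} (hc : 0 < c) (hC : 0 < C) (hν1 : 0 < (ν 1).toReal)
    (hν : ∀ x, c * (1 / ((1 + N x) ^ α * ballVolume N (N x))) ≤ (ν x).toReal)
    (hν' : ∀ x, (ν x).toReal ≤ C * (1 / ((1 + N x) ^ α * ballVolume N (N x)))) :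
    ∃ A B : ℝ, 0 < A ∧ 0 < B ∧ ∀ r, 1 ≤ r → ∀ k : ℕ,
      tailProb N (convPow ν k) (A * r) ≤ ENNReal.ofReal (B * k * r ^ (-α)) := by
  have hV1 : ∀ r, 0 ≤ r → 1 ≤ ballVolume N r := fun r hr => one_le_ballVolume hN hfin hr
  obtain ⟨A, hA1, hinv⟩ := exists_inv_le hN hfin hα hsymm hc hC hν hν'
  obtain ⟨M, hM, hmom⟩ := exists_truncated_moment_le hfin hN.nonneg hV1 hdbl hα hα2 hC hν'
  obtain ⟨D, hD, hVD⟩ := hdbl 2 two_pos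
  -- For `r ≥ 1`, `2r + A(1 + r) ≤ (2 + 2A)r`. Doubling lets `V r` cancel from both sides.
  have heven : ∀ r, 1 ≤ r → ∀ j : ℕ, tailProb N (convPow ν (2 * j)) ((2 + 2 * A) * r)
      ≤ ENNReal.ofReal (4 * D * M * 2 ^ (2 - α) * (2 * j : ℕ) * r ^ (-α)) := by
    intro r hr j
    have hr0 : 0 < r := by linarith
    have hVr := hV1 r hr0.le
    have hVr2 := hV1 (2 * r) (by positivity)
    have h1 := tailProb_convPow_even_le hN hfin hsymm (by linarith : 0 ≤ A) hinv hr0.le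
      (by nlinarith : 2 * r + A * (1 + r) ≤ (2 + 2 * A) * r) j
    have h2 : ENNReal.ofReal (ballVolume N r)
        * tailProb N (convPow ν (2 * j)) ((2 + 2 * A) * r) * ENNReal.ofReal (r ^ 2)
        ≤ ENNReal.ofReal (2 * j * (4 * (D * ballVolume N r) * (M * (2 * r) ^ (2 - α)))) := by
      refine h1.trans ?_
      rw [ENNReal.ofReal_mul (by positivity), ENNReal.ofReal_mul (by positivity),
        ENNReal.ofReal_mul (by positivity), ENNReal.ofReal_mul (by positivity)]
      simp only [ENNReal.ofReal_ofNat, ENNReal.ofReal_natCast]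
      gcongr
      · exact hVD r hr0.le
      · exact hmom _ (by positivity)
    have h3 : tailProb N (convPow ν (2 * j)) ((2 + 2 * A) * r)
        * ENNReal.ofReal (ballVolume N r * r ^ 2) ≤
        ENNReal.ofReal (4 * D * M * 2 ^ (2 - α) * (2 * j : ℕ) * r ^ (-α))
          * ENNReal.ofReal (ballVolume N r * r ^ 2) := by
      rw [← ENNReal.ofReal_mul (by positivity), ENNReal.ofReal_mul (p := ballVolume N r)
        (by positivity)]
      convert h2 using 1
      · ring
      · congr 1
        rw [Real.mul_rpow two_pos.le hr0.le, Real.rpow_sub hr0, Real.rpow_neg hr0.le, Real.rpow_two]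
        push_cast
        field_simp
    exact (ENNReal.mul_le_mul_iff_left (ENNReal.ofReal_pos.2 (by positivity)).ne'
      ENNReal.ofReal_ne_top).1 h3
  set B := 4 * D * M * 2 ^ (2 - α) with hB
  have hB0 : 0 < B := by positivity
  clear_value B
  refine ⟨2 + 2 * A, 2 * B / (ν 1).toReal, by linarith, by positivity, fun r hr k => ?_⟩
  have hr0 : 0 < r := by linarith
  have hνle := toReal_apply_le_one ν 1
  have hBB : 2 * B ≤ 2 * B / (ν 1).toReal := by
    rw [le_div_iff₀ hν1]
    nlinarith
  rcases Nat.even_or_odd' k with ⟨j, rfl | rfl⟩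
  · refine (heven r hr j).trans (ENNReal.ofReal_le_ofReal ?_)
    gcongr
    linarith
  -- An odd time is compared with the next even one by staying put with probability `ν 1`.
  · have h1 := (mul_tailProb_le N ν (2 * j + 1) ((2 + 2 * A) * r)).trans (heven r hr (j + 1))
    have h2 : ν 1 * tailProb N (convPow ν (2 * j + 1)) ((2 + 2 * A) * r)
        ≤ ν 1 * ENNReal.ofReal (2 * B / (ν 1).toReal * (2 * j + 1 : ℕ) * r ^ (-α)) := by
      refine h1.trans ?_
      calc ENNReal.ofReal (B * (2 * (j + 1) : ℕ) * r ^ (-α))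
          ≤ ENNReal.ofReal ((ν 1).toReal
              * (2 * B / (ν 1).toReal * (2 * j + 1 : ℕ) * r ^ (-α))) := by
            apply ENNReal.ofReal_le_ofReal
            rw [← mul_assoc, ← mul_assoc, mul_div_cancel₀ _ hν1.ne']
            gcongr ?_ * _
            push_cast
            nlinarith
        _ = _ := by rw [ENNReal.ofReal_mul hν1.le, ENNReal.ofReal_toReal (ν.apply_ne_top 1)]
    exact (ENNReal.mul_le_mul_iff_right (fun h => by simp [h] at hν1) (ν.apply_ne_top 1)).1 h2

theorem exists_tailProb_scale_le {α : ℝ} (hα : 0 < α) {ν : PMF G} {A B : ℝ} (hA : 0 < A)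
    (hB : 0 < B) (h : ∀ r, 1 ≤ r → ∀ k : ℕ,
      tailProb N (convPow ν k) (A * r) ≤ ENNReal.ofReal (B * k * r ^ (-α)))
    {ε : ℝ} (hε : 0 < ε) :
    ∃ γ : ℝ, 0 < γ ∧ ∀ n : ℕ, 1 ≤ n → ∀ k ≤ n,
      tailProb N (convPow ν k) (γ * (n : ℝ) ^ (1 / α)) ≤ ENNReal.ofReal ε := by
  -- Large enough that `B * s ^ (-α) ≤ ε`, and at least `1` so that the tail bound applies.
  set s := max 1 ((B / ε) ^ (1 / α)) with hs
  have hs1 : 1 ≤ s := le_max_left _ _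
  have hsα : B * s ^ (-α) ≤ ε := by
    have h1 : B / ε ≤ s ^ α := by
      calc B / ε = ((B / ε) ^ (1 / α)) ^ α := by
            rw [← Real.rpow_mul (by positivity), one_div_mul_cancel hα.ne', Real.rpow_one]
        _ ≤ s ^ α := by gcongr; exact le_max_right _ _
    rw [Real.rpow_neg (by positivity), ← div_eq_mul_inv, div_le_iff₀ (by positivity)]
    rwa [div_le_iff₀' hε] at h1
  refine ⟨A * s, by positivity, fun n hn k hk => ?_⟩
  have hn1 : (1 : ℝ) ≤ n := by exact_mod_cast hn
  have hnα : 1 ≤ (n : ℝ) ^ (1 / α) := Real.one_le_rpow hn1 (by positivity)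
  rw [mul_assoc]
  refine (h _ (by nlinarith) k).trans (ENNReal.ofReal_le_ofReal ?_)
  have hkn : (k : ℝ) ≤ n := by exact_mod_cast hk
  calc B * k * (s * (n : ℝ) ^ (1 / α)) ^ (-α) ≤ B * n * (s * (n : ℝ) ^ (1 / α)) ^ (-α) := by gcongr
    _ = B * s ^ (-α) := by
        rw [Real.mul_rpow (by positivity) (by positivity), ← Real.rpow_mul (by positivity),
          mul_neg, one_div_mul_cancel hα.ne', Real.rpow_neg_one]
        field_simp
    _ ≤ ε := hsα

/-- At least half of the mass of `p = ν^(m)` lies in the ball, so Cauchy–Schwarz gives `1/4 ≤ V L *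
∑ p²`, and `∑ p² = ν^(2m)(1)`. -/
theorem one_le_mul_convPow_one (hfin : ∀ r, {g | N g ≤ r}.Finite) {ν : PMF G} (hsymm : IsSymm ν)
    {m : ℕ} {L : ℝ} (h : tailProb N (convPow ν m) L ≤ 2⁻¹) :
    1 ≤ 4 * ballVolume N L * (convPow ν (2 * m) 1).toReal := by
  set p := convPow ν m with hp
  set s := (hfin L).toFinset with hs
  have hhead : headProb N p L = ∑ x ∈ s, p x := by
    rw [headProb, tsum_eq_sum (s := s)]
    · refine Finset.sum_congr rfl fun x hx => ?_
      have : N x ≤ L := by simpa [hs] using hx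
      simp [this]
    · intro x hx
      have : ¬ N x ≤ L := by simpa [hs] using hx
      simp [this]
  have h1 : (1 : ℝ) / 2 ≤ ∑ x ∈ s, (p x).toReal := by
    have htop : ∑ x ∈ s, p x ≠ ⊤ := ENNReal.sum_ne_top.2 fun x _ => p.apply_ne_top x
    have := ENNReal.toReal_mono htop (hhead ▸ half_le_headProb h)
    rw [ENNReal.toReal_sum fun x _ => p.apply_ne_top x] at this
    simpa using this
  have h2 : ∑ x ∈ s, (p x).toReal ^ 2 ≤ (convPow ν (2 * m) 1).toReal := by
    have : ∑ x ∈ s, p x * p x ≤ convPow ν (2 * m) 1 := by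
      rw [two_mul, convPow_add, conv_apply_one (hsymm.convPow m)]
      exact ENNReal.sum_le_tsum s
    have := ENNReal.toReal_mono (PMF.apply_ne_top _ _) this
    rw [ENNReal.toReal_sum fun x _ => ENNReal.mul_ne_top (p.apply_ne_top x) (p.apply_ne_top x)]
      at this
    simpa [sq] using this
  have h3 := sq_sum_le_card_mul_sum_sq (s := s) (f := fun x => (p x).toReal)
  have h4 : (s.card : ℝ) = ballVolume N L := by
    rw [ballVolume, Set.ncard_eq_toFinset_card _ (hfin L)]
  rw [h4] at h3
  have h5 : 0 ≤ ballVolume N L := by rw [← h4]; positivity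
  nlinarith [mul_le_mul_of_nonneg_left h2 h5]

theorem mul_le_convPow_one (ν : PMF G) (n : ℕ) :
    (ν 1).toReal * (convPow ν (2 * (n / 2)) 1).toReal ≤ (convPow ν n 1).toReal := by
  rcases Nat.mod_two_eq_zero_or_one n with h | h
  · rw [show 2 * (n / 2) = n by omega]
    exact mul_le_of_le_one_left ENNReal.toReal_nonneg (toReal_apply_le_one ν 1)
  · rw [← ENNReal.toReal_mul, mul_comm]
    refine ENNReal.toReal_mono (PMF.apply_ne_top _ _) ?_
    conv_rhs => rw [show n = 2 * (n / 2) + 1 by omega, show (1 : G) = 1 * 1 by simp]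
    exact mul_le_conv_apply _ _ _ _

end TailProb

/-! ### Maximal inequality for the walk. -/

section Maximal

variable {G : Type*}

/-- The sequence with first term `y` followed by `ξ`. -/
def consSeq (y : G) (ξ : ℕ → G) : ℕ → G
  | 0 => y
  | n + 1 => ξ n

theorem walk_consSeq [Group G] (y : G) (ξ : ℕ → G) (k : ℕ) :
    walk (consSeq y ξ) (k + 1) = y * walk ξ k := by
  induction k with
  | zero => simp [walk, consSeq]
  | succ k ih => rw [walk, ih, walk, mul_assoc]; rfl

variable [MeasurableSpace G]

theorem measurable_consSeq : Measurable fun p : G × (ℕ → G) => consSeq p.1 p.2 := by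
  refine measurable_pi_lambda _ fun n => ?_
  cases n with
  | zero => exact measurable_fst
  | succ n => exact (measurable_pi_apply n).comp measurable_snd

instance (ν : PMF G) : IsProbabilityMeasure (incrementLaw ν) := by
  unfold incrementLaw; infer_instance

/-- The source of the Markov property at time one. Boxes determine the law; padding the index set to
an initial segment lets the first coordinate split off. -/
theorem map_consSeq_incrementLaw (ν : PMF G) :
    (ν.toMeasure.prod (incrementLaw ν)).map (fun p => consSeq p.1 p.2) = incrementLaw ν := by
  classical
  refine Measure.eq_infinitePi _ fun s t ht => ?_
  obtain ⟨M, hM⟩ := s.exists_nat_subset_range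
  set t' : ℕ → Set G := fun i => if i ∈ s then t i else Set.univ with ht'
  have hmt : ∀ i, MeasurableSet (t' i) := fun i => by
    simp only [ht']; split_ifs
    · exact ht i
    · exact MeasurableSet.univ
  have hsub : s ⊆ Finset.range (M + 1) :=
    hM.trans (Finset.range_subset_range.2 (Nat.le_succ M))
  have hpi : Set.pi (s : Set ℕ) t = Set.pi (Finset.range (M + 1) : Set ℕ) t' := by
    ext ξ
    simp only [Set.mem_pi, Finset.mem_coe]
    constructor
    · intro h i _
      by_cases hi : i ∈ s
      · simpa [ht', hi] using h i hi
      · simp [ht', hi]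
    · intro h i hi
      simpa [ht', hi] using h i (hsub hi)
  have hprod : ∏ i ∈ s, ν.toMeasure (t i) = ∏ i ∈ Finset.range (M + 1), ν.toMeasure (t' i) := by
    rw [← Finset.prod_subset hsub]
    · exact Finset.prod_congr rfl fun i hi => by simp [ht', hi]
    · intro i _ hi
      simp [ht', hi]
  have hpre : (fun p : G × (ℕ → G) => consSeq p.1 p.2) ⁻¹'
      Set.pi (Finset.range (M + 1) : Set ℕ) t'
      = t' 0 ×ˢ Set.pi (Finset.range M : Set ℕ) fun i => t' (i + 1) := by
    ext p
    simp only [Set.mem_preimage, Set.mem_pi, Finset.mem_coe, Finset.mem_range, Set.mem_prod]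
    constructor
    · exact fun h => ⟨h 0 (Nat.succ_pos M), fun i hi => h (i + 1) (Nat.succ_lt_succ hi)⟩
    · rintro ⟨h0, h⟩ i hi
      cases i with
      | zero => exact h0
      | succ i => exact h i (Nat.lt_of_succ_lt_succ hi)
  rw [hpi, hprod, Measure.map_apply measurable_consSeq
    (MeasurableSet.pi (Finset.countable_toSet _) fun i _ => hmt i), hpre, Measure.prod_prod,
    incrementLaw, Measure.infinitePi_pi _ fun i _ => hmt (i + 1), Finset.prod_range_succ', mul_comm]

variable [DiscreteMeasurableSpace G] [Countable G]

theorem incrementLaw_apply_eq_tsum (ν : PMF G) {E : Set (ℕ → G)} (hE : MeasurableSet E) :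
    incrementLaw ν E = ∑' y, ν y * incrementLaw ν {ξ | consSeq y ξ ∈ E} := by
  conv_lhs => rw [← map_consSeq_incrementLaw, Measure.map_apply measurable_consSeq hE,
    Measure.prod_apply (measurable_consSeq hE), lintegral_countable']
  refine tsum_congr fun y => ?_
  rw [PMF.toMeasure_apply_singleton _ _ (MeasurableSet.singleton y), mul_comm]
  rfl

variable [Group G]

theorem measurable_walk (k : ℕ) : Measurable fun ξ : ℕ → G => walk ξ k := by
  induction k with
  | zero => exact measurable_const
  | succ k ih =>
    exact (measurable_of_countable fun p : G × G => p.1 * p.2).comp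
      (ih.prodMk (measurable_pi_apply k))

/-- The increments for which the walk started at `x` reaches `N ≥ a` within `n` steps. -/
def exceedance (N : G → ℝ) (a : ℝ) (n : ℕ) (x : G) : Set (ℕ → G) :=
  {ξ | ∃ k ≤ n, a ≤ N (x * walk ξ k)}

theorem measurableSet_exceedance (N : G → ℝ) (a : ℝ) (n : ℕ) (x : G) :
    MeasurableSet (exceedance N a n x) := by
  have : exceedance N a n x = ⋃ k ∈ Set.Iic n, (fun ξ => walk ξ k) ⁻¹' {g | a ≤ N (x * g)} := by
    ext ξ
    simp [exceedance]
  rw [this]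
  exact MeasurableSet.biUnion (Set.to_countable _) fun k _ =>
    measurable_walk k (MeasurableSet.of_discrete)

/-- Ottaviani's maximal inequality. -/
theorem mul_incrementLaw_exceedance_le {N : G → ℝ} (hN : IsNorm N) (ν : PMF G) {θ : ℝ≥0∞}
    {a b : ℝ} (n : ℕ)
    (hθ : ∀ k ≤ n, θ ≤ ∑' z, convPow ν k z * {g | N g⁻¹ ≤ b}.indicator 1 z) (x : G) :
    θ * incrementLaw ν (exceedance N a n x)
      ≤ ∑' z, convPow ν n z * {g | a - b ≤ N (x * g)}.indicator 1 z := by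
  -- If the start is already beyond `a`, a final displacement `g` with `N g⁻¹ ≤ b` cannot bring the
  -- walk below `a - b`.
  have hstart : ∀ n x, a ≤ N x →
      θ ≤ ∑' z, convPow ν n z * {g | N g⁻¹ ≤ b}.indicator 1 z →
      θ * incrementLaw ν (exceedance N a n x)
        ≤ ∑' z, convPow ν n z * {g | a - b ≤ N (x * g)}.indicator 1 z := by
    intro n x hx hn
    calc θ * incrementLaw ν (exceedance N a n x) ≤ θ * 1 := by gcongr; exact prob_le_one
      _ ≤ ∑' z, convPow ν n z * {g | N g⁻¹ ≤ b}.indicator 1 z := by rwa [mul_one]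
      _ ≤ _ := by
        refine ENNReal.tsum_le_tsum fun z => ?_
        gcongr _ * ?_
        refine Set.indicator_le_indicator_of_subset (fun g hg => ?_) (fun _ => zero_le_one) z
        have h1 := hN.mul_le (x * g) g⁻¹
        rw [mul_inv_cancel_right] at h1
        have h2 : N g⁻¹ ≤ b := hg
        change a - b ≤ N (x * g)
        linarith
  -- Conditioning on the first increment, with the start arbitrary, replaces the decomposition by
  -- first passage time.
  induction n generalizing x with
  | zero =>
    by_cases hx : a ≤ N x
    · exact hstart 0 x hx (hθ 0 le_rfl)
    · have : exceedance N a 0 x = ∅ := by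
        ext ξ
        simpa [exceedance, walk] using hx
      simp [this]
  | succ n ih =>
    by_cases hx : a ≤ N x
    · exact hstart (n + 1) x hx (hθ (n + 1) le_rfl)
    · have hshift : ∀ y, {ξ | consSeq y ξ ∈ exceedance N a (n + 1) x}
          = exceedance N a n (x * y) := by
        intro y
        ext ξ
        simp only [exceedance, Set.mem_ofPred_eq]
        constructor
        · rintro ⟨k, hk, h⟩
          cases k with
          | zero => exact absurd (by simpa [walk] using h) hx
          | succ k =>
            rw [walk_consSeq, ← mul_assoc] at h
            exact ⟨k, Nat.le_of_succ_le_succ hk, h⟩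
        · rintro ⟨k, hk, h⟩
          refine ⟨k + 1, Nat.succ_le_succ hk, ?_⟩
          rwa [walk_consSeq, ← mul_assoc]
      rw [incrementLaw_apply_eq_tsum ν (measurableSet_exceedance N a (n + 1) x), convPow_succ',
        tsum_conv_mul, ← ENNReal.tsum_mul_left]
      refine ENNReal.tsum_le_tsum fun y => ?_
      rw [hshift, mul_left_comm]
      gcongr
      refine (ih (fun k hk => hθ k (hk.trans n.le_succ)) (x * y)).trans_eq
        (tsum_congr fun z => ?_)
      simp only [Set.indicator, Set.mem_ofPred_eq, mul_assoc, Pi.one_apply]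

/-- Ottaviani with `a = 2L`, `b = L`, `θ = 1/2`; symmetry of the powers removes the inverse in `N
g⁻¹`. -/
theorem incrementLaw_real_le_of_tailProb {N : G → ℝ} (hN : IsNorm N) {ν : PMF G}
    (hsymm : IsSymm ν) {L ε : ℝ} (hε : 0 ≤ ε) {n : ℕ}
    (h : ∀ k ≤ n, tailProb N (convPow ν k) L ≤ 2⁻¹)
    (hn : tailProb N (convPow ν n) L ≤ ENNReal.ofReal (ε / 2)) :
    (incrementLaw ν).real {ξ | 2 * L ≤ runningMax N ξ n} ≤ ε := by
  have hsub : {ξ | 2 * L ≤ runningMax N ξ n} ⊆ exceedance N (2 * L) n 1 := by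
    intro ξ hξ
    obtain ⟨k, hk, hk'⟩ := (Finset.le_sup'_iff _).1 (show 2 * L ≤ runningMax N ξ n from hξ)
    exact ⟨k, Nat.lt_succ_iff.1 (Finset.mem_range.1 hk), by rwa [one_mul]⟩
  have hθ : ∀ k ≤ n, 2⁻¹ ≤ ∑' z, convPow ν k z * {g | N g⁻¹ ≤ L}.indicator 1 z := by
    intro k hk
    refine (half_le_headProb (h k hk)).trans_eq ?_
    rw [headProb, ← (Equiv.inv G).tsum_eq]
    refine tsum_congr fun z => ?_
    rw [Equiv.inv_apply, hsymm.convPow k z]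
    rfl
  have hmax := mul_incrementLaw_exceedance_le hN ν (a := 2 * L) n hθ 1
  have hle : incrementLaw ν (exceedance N (2 * L) n 1) ≤ ENNReal.ofReal ε := by
    have h1 : 2⁻¹ * incrementLaw ν (exceedance N (2 * L) n 1) ≤ 2⁻¹ * ENNReal.ofReal ε := by
      refine hmax.trans (le_trans (le_of_eq ?_) (hn.trans_eq ?_))
      · simp only [one_mul, two_mul, add_sub_cancel_right]
        rfl
      · rw [div_eq_inv_mul, ENNReal.ofReal_mul (by norm_num), ENNReal.ofReal_inv_of_pos two_pos,
          ENNReal.ofReal_ofNat]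
    exact (ENNReal.mul_le_mul_iff_right (by simp) (by simp)).1 h1
  exact ENNReal.toReal_le_of_le_ofReal hε ((measure_mono hsub).trans hle)

end Maximal

end WalkControl

/-! ### Assembly of the estimates. -/

theorem mainTheorem7 {G : Type*} [Group G] [Group.FG G]
    [MeasurableSpace G] [DiscreteMeasurableSpace G]
    (N : G → ℝ) (hN : WalkControl.IsNorm N)
    (d : ℝ) (hd : 0 < d) (hV : WalkControl.RegularlyVarying (WalkControl.ballVolume N) d)
    (α : ℝ) (hα : α ∈ Set.Ioo (0 : ℝ) 2)
    (ν : PMF G) (hsymm : WalkControl.IsSymm ν)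
    (hν : WalkControl.ComparableOn Set.univ (fun x : G => (ν x).toReal)
      (fun x : G => 1 / ((1 + N x) ^ α * WalkControl.ballVolume N (N x)))) :
    WalkControl.ComparableOn {n : ℕ | 1 ≤ n}
        (fun n => (WalkControl.convPow ν n 1).toReal)
        (fun n => (WalkControl.ballVolume N ((n : ℝ) ^ (1 / α)))⁻¹) ∧
      WalkControl.IsControlled ν N (fun t : ℝ => t ^ (1 / α)) := by
  obtain ⟨hα0, hα2⟩ := hα
  obtain ⟨c, C, hc, hC, hcC⟩ := hν
  have hν1 : ∀ x, c * (1 / ((1 + N x) ^ α * WalkControl.ballVolume N (N x))) ≤ (ν x).toReal :=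
    fun x => (hcC x (Set.mem_univ x)).1
  have hν2 : ∀ x, (ν x).toReal ≤ C * (1 / ((1 + N x) ^ α * WalkControl.ballVolume N (N x))) :=
    fun x => (hcC x (Set.mem_univ x)).2
  have hfin := hV.finite_ball
  have hdbl := hV.volumeDoubling hN
  have hmono := WalkControl.ballVolume_mono hfin
  have hV1 : ∀ r, 0 ≤ r → 1 ≤ WalkControl.ballVolume N r :=
    fun r hr => WalkControl.one_le_ballVolume hN hfin hr
  have hpos : 0 < (ν 1).toReal := by
    refine lt_of_lt_of_le ?_ (hν1 1)
    have := hV1 _ (hN.nonneg 1)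
    have := hN.nonneg 1
    positivity
  have hcount : Countable G := by
    rw [← Set.countable_univ_iff]
    refine (Set.countable_iUnion fun n : ℕ => (hfin n).countable).mono fun g _ => ?_
    obtain ⟨n, hn⟩ := exists_nat_ge (N g)
    exact Set.mem_iUnion.2 ⟨n, hn⟩
  obtain ⟨C', hC', hup⟩ :=
    WalkControl.exists_convPow_one_le hN hfin hdbl hα0 hsymm hc hν1
  obtain ⟨A, B, hA, hB, htail⟩ :=
    WalkControl.exists_tailProb_le hN hfin hdbl hα0 hα2 hsymm hc hC hpos hν1 hν2
  have htight := fun ε (hε : 0 < ε) =>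
    WalkControl.exists_tailProb_scale_le hα0 hA hB htail (ε := ε) hε
  have hhalf : ENNReal.ofReal (1 / 2) = 2⁻¹ := by
    rw [one_div, ENNReal.ofReal_inv_of_pos two_pos, ENNReal.ofReal_ofNat]
  obtain ⟨γ, hγ, hγt⟩ := htight (1 / 2) (by norm_num)
  obtain ⟨D, hD, hVD⟩ := hdbl γ hγ
  -- Allowing every `m ≤ n` serves both `m = n` and `m = n / 2` without a further doubling argument.
  have hlow : ∀ n : ℕ, 1 ≤ n → ∀ m ≤ n,
      (4 * D)⁻¹ * (WalkControl.ballVolume N ((n : ℝ) ^ (1 / α)))⁻¹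
        ≤ (WalkControl.convPow ν (2 * m) 1).toReal := by
    intro n hn m hm
    have h1 := WalkControl.one_le_mul_convPow_one hfin hsymm ((hγt n hn m hm).trans_eq hhalf)
    have h2 := hVD ((n : ℝ) ^ (1 / α)) (by positivity)
    have h3 := hV1 ((n : ℝ) ^ (1 / α)) (by positivity)
    rw [← mul_inv, inv_le_iff_one_le_mul₀ (by positivity)]
    refine h1.trans ?_
    rw [mul_comm _ (4 * D * _), mul_assoc 4 D]
    gcongr
  refine ⟨⟨(ν 1).toReal * (4 * D)⁻¹, C', by positivity, hC', fun n hn => ⟨?_, ?_⟩⟩,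
    hN, hsymm, fun t ht => by positivity, ?_, ⟨(4 * D)⁻¹, C', by positivity, hC',
      fun n hn => ⟨hlow n hn n le_rfl, ?_⟩⟩, fun ε hε => ?_⟩
  · rw [mul_assoc]
    refine le_trans ?_ (WalkControl.mul_le_convPow_one ν n)
    gcongr
    exact hlow n hn (n / 2) (Nat.div_le_self n 2)
  · exact (hup n).trans_eq (div_eq_mul_inv _ _)
  · intro s hs t ht hst
    exact Real.rpow_le_rpow (le_of_lt hs) hst (by positivity)
  · refine (hup (2 * n)).trans ?_
    have h3 := hV1 ((n : ℝ) ^ (1 / α)) (by positivity)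
    rw [div_eq_mul_inv]
    have h4 : WalkControl.ballVolume N ((n : ℝ) ^ (1 / α))
        ≤ WalkControl.ballVolume N (((2 * n : ℕ) : ℝ) ^ (1 / α)) := by
      refine hmono ?_
      gcongr
      linarith
    exact mul_le_mul_of_nonneg_left (inv_anti₀ (by linarith) h4) hC'.le
  -- The level `1/2` feeds `θ = 1/2` in the maximal inequality; `ε / 2` pays for the division by
  -- `θ`.
  · obtain ⟨δ, hδ, hδt⟩ := htight (min (1 / 2) (ε / 2)) (by positivity)
    refine ⟨2 * δ, by positivity, fun n hn => ?_⟩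
    simp only [mul_assoc]
    refine WalkControl.incrementLaw_real_le_of_tailProb hN hsymm hε.le (fun k hk => ?_) ?_
    · exact (hδt n hn k hk).trans
        ((ENNReal.ofReal_le_ofReal (min_le_left _ _)).trans_eq hhalf)
    · exact (hδt n hn n le_rfl).trans (ENNReal.ofReal_le_ofReal (min_le_right _ _))
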